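/- Let $m$ be Lebesgue measure on $(0,\infty)$. For a real measurable function $z$ on $(0,\infty)$ let $\mu(t;z)=\inf\{s\ge 0 : m(\{|z|>s\})\le t\}$ be the decreasing rearrangement of $|z|$, and write $z_+=\max(z,0)$, $z_-=\max(-z,0)$. Write $w\prec\prec z$ if $\int_0^t\mu(s;w)\,ds\le\int_0^t\mu(s;z)\,ds$ for all $t\ge 0$. For real-valued $x,y\in L_1(0,\infty)$ write $x\prec y$ (Hardy--Littlewood--P\'olya majorization) if $x_+\prec\prec y_+$, $x_-\prec\prec y_-$ and $\int_0^\infty x\,dm=\int_0^\infty y\,dm$. Proposition. Let $x,y\in L_1(0,\infty)$ be real-valued. Then $x\prec y$ if and only if $\int_0^\infty f(x)\,dm\le\int_0^\infty f(y)\,dm$ for every convex function $f:\mathbb R\to\mathbb R$ with $f(0)=0$ such that $f(x)$ and $f(y)$ are integrable on $(0,\infty)$. -/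

import Mathlib

open MeasureTheory

/-- The decreasing rearrangement of `|x|` for a real function `x` on a measure space:
`μ(t; x) = inf {s ≥ 0 : m {|x| > s} ≤ t}`, with values in `[0, ∞]`.
The value `∞` can occur only if every finite level `s` has `m {|x| > s} > t`. -/
noncomputable def decreasingRearrangement {α : Type*} [MeasurableSpace α] (m : Measure α)
    (x : α → ℝ) (t : ℝ) : ENNReal :=
  sInf {s : ENNReal | m {u | s < ENNReal.ofReal |x u|} ≤ ENNReal.ofReal t}

/-- Hardy–Littlewood–Pólya submajorization `x ≺≺ y`:
`∫₀ᵗ μ(s; x) ds ≤ ∫₀ᵗ μ(s; y) ds` for all `t ≥ 0`. -/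
def IsSubmajorized {α : Type*} [MeasurableSpace α] (m : Measure α) (x y : α → ℝ) : Prop :=
  ∀ t : ℝ, 0 ≤ t →
    ∫⁻ s in Set.Ioo 0 t, decreasingRearrangement m x s ≤
      ∫⁻ s in Set.Ioo 0 t, decreasingRearrangement m y s

/-- Hardy–Littlewood–Pólya majorization `x ≺ y` of (integrable) real functions:
`x₊ ≺≺ y₊`, `x₋ ≺≺ y₋` and `∫ x = ∫ y`. -/
def IsMajorized {α : Type*} [MeasurableSpace α] (m : Measure α) (x y : α → ℝ) : Prop :=
  IsSubmajorized m (fun u => max (x u) 0) (fun u => max (y u) 0) ∧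
    IsSubmajorized m (fun u => max (-x u) 0) (fun u => max (-y u) 0) ∧
    ∫ u, x u ∂m = ∫ u, y u ∂m

/-! Everything passes through the distribution function `D u = m {x > u}`. By Tonelli, the integral
of the rearrangement over `(0, t)` is `∫ min (D u) t du`. Comparing these truncations for all `t` is
equivalent to comparing the tails `∫_c^∞ D = ∫ (x - c)₊` for all `c ≥ 0` (`isSubmajorized_iff`).

Given majorization, subtract from `f` a supporting line at `0`; this is harmless because the
integrals of `x` and `y` agree. The resulting `g ≥ 0` vanishes at `0`, so it can be treated
separately on positive and negative parts. There `∫ g(x₊) = ∫ D g'`, and since `g'` is nonnegative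
and increasing this is a mixture of tails.

Conversely, the test functions `(t - c)₊`, `(-t - c)₊`, `t` and `-t` recover the three conditions.
-/

theorem ofReal_lt_decreasingRearrangement_iff {α : Type*} [MeasurableSpace α] (m : Measure α)
    (x : α → ℝ) (s : ℝ) {u : ℝ} (hu : 0 ≤ u) :
    ENNReal.ofReal u < decreasingRearrangement m x s ↔ ENNReal.ofReal s < m {ω | u < |x ω|} := by
  have hset : ∀ v : ℝ, 0 ≤ v →
      {ω | ENNReal.ofReal v < ENNReal.ofReal |x ω|} = {ω | v < |x ω|} := by
    intro v hv
    ext ω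
    simp only [Set.mem_ofPred_eq]
    exact ENNReal.ofReal_lt_ofReal_iff_of_nonneg hv
  constructor
  · intro h
    contrapose! h
    refine sInf_le ?_
    rw [Set.mem_ofPred_eq, hset u hu]
    exact h
  · intro h
    contrapose! h
    -- Right continuity of the distribution function: the strict superlevel set is an increasing
    -- union of higher ones, each of measure at most `s` because its level exceeds the infimum.
    have hunion : {ω | u < |x ω|} = ⋃ n : ℕ, {ω | u + 1 / ((n : ℝ) + 1) < |x ω|} := by
      ext ω
      simp only [Set.mem_ofPred_eq, Set.mem_iUnion]
      constructor
      · intro hω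
        obtain ⟨n, hn⟩ := exists_nat_one_div_lt (sub_pos.2 hω)
        exact ⟨n, by linarith⟩
      · rintro ⟨n, hn⟩
        have : (0 : ℝ) < 1 / ((n : ℝ) + 1) := Nat.one_div_pos_of_nat
        linarith
    have hmono : Monotone fun n : ℕ => {ω | u + 1 / ((n : ℝ) + 1) < |x ω|} := by
      intro a b hab ω hω
      have : 1 / ((b : ℝ) + 1) ≤ 1 / ((a : ℝ) + 1) := Nat.one_div_le_one_div hab
      simp only [Set.mem_ofPred_eq] at hω ⊢
      linarith
    rw [hunion, hmono.measure_iUnion]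
    refine iSup_le fun n => ?_
    have hpos : (0 : ℝ) < 1 / ((n : ℝ) + 1) := Nat.one_div_pos_of_nat
    have hlt : decreasingRearrangement m x s < ENNReal.ofReal (u + 1 / ((n : ℝ) + 1)) :=
      h.trans_lt ((ENNReal.ofReal_lt_ofReal_iff (by positivity)).2 (by linarith))
    obtain ⟨r, hr, hru⟩ := sInf_lt_iff.1 hlt
    refine le_trans (measure_mono ?_) hr
    intro ω hω
    rw [← hset _ (by positivity)] at hω
    exact hru.trans hω

theorem antitone_measure_lt {α : Type*} [MeasurableSpace α] (m : Measure α) (x : α → ℝ) :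
    Antitone fun u : ℝ => m {ω | u < x ω} :=
  fun _ _ hab => measure_mono fun _ hω => lt_of_le_of_lt hab hω

theorem volume_setOf_ofReal_lt (a : ENNReal) :
    volume {u : ℝ | 0 < u ∧ ENNReal.ofReal u < a} = a := by
  induction a using ENNReal.recTopCoe with
  | top =>
    have : {u : ℝ | 0 < u ∧ ENNReal.ofReal u < ⊤} = Set.Ioi 0 := by ext; simp
    rw [this, Real.volume_Ioi]
  | coe r =>
    have : {u : ℝ | 0 < u ∧ ENNReal.ofReal u < r} = Set.Ioo 0 (r : ℝ) := by
      ext u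
      simp only [Set.mem_ofPred_eq, Set.mem_Ioo]
      refine and_congr_right fun hu => ?_
      rw [ENNReal.ofReal_lt_iff_lt_toReal hu.le ENNReal.coe_ne_top, ENNReal.coe_toReal]
    rw [this, Real.volume_Ioo, sub_zero, ENNReal.ofReal_coe_nnreal]

/-- Both sides measure the region `s < D u` with `0 < s < t` and `u > 0`, sliced in the two
directions. -/
theorem lintegral_decreasingRearrangement {α : Type*} [MeasurableSpace α] (m : Measure α)
    (x : α → ℝ) (t : ℝ) :
    ∫⁻ s in Set.Ioo 0 t, decreasingRearrangement m x s =
      ∫⁻ u in Set.Ioi (0 : ℝ), min (m {ω | u < |x ω|}) (ENNReal.ofReal t) := by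
  set D : ℝ → ENNReal := fun u => m {ω | u < |x ω|} with hD
  have hDm : Measurable D := (antitone_measure_lt m fun ω => |x ω|).measurable
  set S : Set (ℝ × ℝ) := {p | ENNReal.ofReal p.1 < D p.2} with hS
  have hSm : MeasurableSet S :=
    measurableSet_lt (ENNReal.measurable_ofReal.comp measurable_fst) (hDm.comp measurable_snd)
  have h1 : ∀ s : ℝ, decreasingRearrangement m x s =
      ∫⁻ u in Set.Ioi (0 : ℝ), S.indicator 1 (s, u) := by
    intro s
    have hm : MeasurableSet {u : ℝ | (s, u) ∈ S} := measurable_prodMk_left hSm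
    have : (fun u => S.indicator (1 : ℝ × ℝ → ENNReal) (s, u)) =
        {u : ℝ | (s, u) ∈ S}.indicator 1 := by
      ext u; simp [Set.indicator_apply]
    rw [this, lintegral_indicator_one hm, Measure.restrict_apply hm,
      ← volume_setOf_ofReal_lt (decreasingRearrangement m x s)]
    congr 1
    ext u
    simp only [Set.mem_ofPred_eq, Set.mem_inter_iff, Set.mem_Ioi, hS]
    rw [and_comm]
    exact and_congr_left fun hu => ofReal_lt_decreasingRearrangement_iff m x s hu.le
  have h2 : ∀ u : ℝ, ∫⁻ s in Set.Ioo 0 t, S.indicator (1 : ℝ × ℝ → ENNReal) (s, u) =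
      min (D u) (ENNReal.ofReal t) := by
    intro u
    have hm : MeasurableSet {s : ℝ | (s, u) ∈ S} := measurable_prodMk_right hSm
    have : (fun s => S.indicator (1 : ℝ × ℝ → ENNReal) (s, u)) =
        {s : ℝ | (s, u) ∈ S}.indicator 1 := by
      ext s; simp [Set.indicator_apply]
    rw [this, lintegral_indicator_one hm, Measure.restrict_apply hm,
      ← volume_setOf_ofReal_lt (min (D u) (ENNReal.ofReal t))]
    congr 1
    ext s
    simp only [Set.mem_ofPred_eq, Set.mem_inter_iff, Set.mem_Ioo, hS, lt_min_iff]
    constructor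
    · rintro ⟨ha, hb, hc⟩
      exact ⟨hb, ha, (ENNReal.ofReal_lt_ofReal_iff_of_nonneg hb.le).2 hc⟩
    · rintro ⟨hb, ha, hc⟩
      exact ⟨ha, hb, (ENNReal.ofReal_lt_ofReal_iff_of_nonneg hb.le).1 hc⟩
  simp_rw [h1]
  rw [lintegral_lintegral_swap]
  · exact lintegral_congr h2
  · exact ((measurable_const.indicator hSm) : Measurable (S.indicator fun _ => (1 : ENNReal))).aemeasurable

/-! ### Truncations, tails and increasing weights -/

theorem lintegral_Ioi_zero_split (F : ℝ → ENNReal) {c : ℝ} (hc : 0 ≤ c) :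
    ∫⁻ u in Set.Ioi (0 : ℝ), F u = (∫⁻ u in Set.Ioc 0 c, F u) + ∫⁻ u in Set.Ioi c, F u := by
  rw [← Set.Ioc_union_Ioi_eq_Ioi hc,
    lintegral_union measurableSet_Ioi (Set.Ioc_disjoint_Ioi le_rfl)]

/-- The endpoint `c = 0` needs a limit, since a distribution function may be infinite at `0`. -/
theorem lintegral_Ioi_le_of_forall_pos {D E : ℝ → ENNReal}
    (h : ∀ c : ℝ, 0 < c → ∫⁻ u in Set.Ioi c, D u ≤ ∫⁻ u in Set.Ioi c, E u)
    {c : ℝ} (hc : 0 ≤ c) : ∫⁻ u in Set.Ioi c, D u ≤ ∫⁻ u in Set.Ioi c, E u := by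
  rcases hc.eq_or_lt with rfl | hc
  · have hU : Set.Ioi (0 : ℝ) = ⋃ n : ℕ, Set.Ioi (1 / ((n : ℝ) + 1)) := by
      ext u
      simp only [Set.mem_Ioi, Set.mem_iUnion]
      exact ⟨fun hu => exists_nat_one_div_lt hu,
        fun ⟨n, hn⟩ => lt_trans Nat.one_div_pos_of_nat hn⟩
    have hmono : Monotone fun n : ℕ => Set.Ioi (1 / ((n : ℝ) + 1)) :=
      fun a b hab => Set.Ioi_subset_Ioi (Nat.one_div_le_one_div hab)
    have hsup : ∫⁻ u in Set.Ioi (0 : ℝ), D u =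
        ⨆ n : ℕ, ∫⁻ u in Set.Ioi (1 / ((n : ℝ) + 1)), D u := by
      rw [← withDensity_apply _ measurableSet_Ioi, hU, hmono.measure_iUnion]
      simp_rw [withDensity_apply _ measurableSet_Ioi]
    rw [hsup]
    exact iSup_le fun n => (h _ Nat.one_div_pos_of_nat).trans
      (lintegral_mono_set (Set.Ioi_subset_Ioi Nat.one_div_pos_of_nat.le))
  · exact h c hc

/-- Truncate at `t = D c`. On `(0, c]` the left side is the constant `t`, which bounds the right
side there; this finite contribution cancels and leaves the tails. -/
theorem lintegral_Ioi_le_of_lintegral_min_le {D E : ℝ → ENNReal} (hD : Antitone D)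
    (hfin : ∀ u, 0 < u → D u ≠ ⊤)
    (h : ∀ t : ℝ, 0 ≤ t → ∫⁻ u in Set.Ioi (0 : ℝ), min (D u) (ENNReal.ofReal t) ≤
      ∫⁻ u in Set.Ioi (0 : ℝ), min (E u) (ENNReal.ofReal t))
    {c : ℝ} (hc : 0 < c) : ∫⁻ u in Set.Ioi c, D u ≤ ∫⁻ u in Set.Ioi c, E u := by
  have key := h (D c).toReal ENNReal.toReal_nonneg
  rw [ENNReal.ofReal_toReal (hfin c hc), lintegral_Ioi_zero_split _ hc.le,
    lintegral_Ioi_zero_split (fun u => min (E u) (D c)) hc.le] at key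
  have e1 : ∫⁻ u in Set.Ioc 0 c, min (D u) (D c) = ∫⁻ _ in Set.Ioc 0 c, D c :=
    setLIntegral_congr_fun measurableSet_Ioc fun u hu => min_eq_right (hD hu.2)
  have e2 : ∫⁻ u in Set.Ioi c, min (D u) (D c) = ∫⁻ u in Set.Ioi c, D u :=
    setLIntegral_congr_fun measurableSet_Ioi fun u hu => min_eq_left (hD (le_of_lt hu))
  have e3 : ∫⁻ _ in Set.Ioc 0 c, D c ≠ ⊤ := by
    rw [setLIntegral_const, Real.volume_Ioc]
    exact ENNReal.mul_ne_top (hfin c hc) ENNReal.ofReal_ne_top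
  rw [e1, e2] at key
  refine (ENNReal.add_le_add_iff_left e3).1 (key.trans (add_le_add ?_ ?_))
  · exact lintegral_mono fun u => min_le_right _ _
  · exact lintegral_mono fun u => min_le_left _ _

theorem lintegral_min_le_of_lintegral_Ioi_le {D E : ℝ → ENNReal} (hE : Antitone E)
    (hlim : Filter.Tendsto E Filter.atTop (nhds 0))
    (h : ∀ c : ℝ, 0 ≤ c → ∫⁻ u in Set.Ioi c, D u ≤ ∫⁻ u in Set.Ioi c, E u)
    {t : ℝ} (ht : 0 ≤ t) : ∫⁻ u in Set.Ioi (0 : ℝ), min (D u) (ENNReal.ofReal t) ≤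
      ∫⁻ u in Set.Ioi (0 : ℝ), min (E u) (ENNReal.ofReal t) := by
  rcases ht.eq_or_lt with rfl | ht
  · simp
  set S : Set ℝ := {u | 0 ≤ u ∧ E u ≤ ENNReal.ofReal t}
  have hne : S.Nonempty := by
    have := (hlim.eventually (ge_mem_nhds (ENNReal.ofReal_pos.2 ht))).and
      (Filter.eventually_ge_atTop (0 : ℝ))
    obtain ⟨u, hu, hu0⟩ := this.exists
    exact ⟨u, hu0, hu⟩
  have hbdd : BddBelow S := ⟨0, fun u hu => hu.1⟩
  -- The level where `E` crosses `t`: the truncation equals `t` before `c` and `E` after it.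
  set c := sInf S
  have hc : 0 ≤ c := le_csInf hne fun u hu => hu.1
  have hgt : ∀ u, c < u → E u ≤ ENNReal.ofReal t := by
    intro u hu
    obtain ⟨v, hv, hvu⟩ := exists_lt_of_csInf_lt hne hu
    exact (hE hvu.le).trans hv.2
  have hlt : ∀ u, 0 ≤ u → u < c → ENNReal.ofReal t ≤ E u := by
    intro u hu huc
    by_contra hcon
    exact absurd (csInf_le hbdd ⟨hu, (not_le.1 hcon).le⟩) (not_le.2 huc)
  rw [lintegral_Ioi_zero_split _ hc,
    lintegral_Ioi_zero_split (fun u => min (E u) (ENNReal.ofReal t)) hc]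
  have hIoc : ∫⁻ u in Set.Ioc 0 c, min (D u) (ENNReal.ofReal t) ≤
      ∫⁻ u in Set.Ioc 0 c, min (E u) (ENNReal.ofReal t) := by
    -- At `c` itself `E` may lie on either side of `t`, so this null point is dropped.
    rw [← restrict_Ioo_eq_restrict_Ioc]
    refine setLIntegral_mono' measurableSet_Ioo fun u hu => ?_
    rw [min_eq_right (hlt u hu.1.le hu.2)]
    exact min_le_right _ _
  have hIoi : ∫⁻ u in Set.Ioi c, min (D u) (ENNReal.ofReal t) ≤
      ∫⁻ u in Set.Ioi c, min (E u) (ENNReal.ofReal t) := by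
    rw [setLIntegral_congr_fun measurableSet_Ioi
      (fun u hu => min_eq_left (hgt u hu) : Set.EqOn _ E _)]
    exact (lintegral_mono fun u => min_le_left _ _).trans (h c hc)
  exact add_le_add hIoc hIoi

/-- Layer cake in the weight: each nonempty superlevel set of the monotone `k` on `(0, ∞)` is a ray
up to its endpoint, so the tail comparison applies level by level. -/
theorem lintegral_mul_le_of_lintegral_Ioi_le {D E : ℝ → ENNReal} (hD : Measurable D)
    (hE : Measurable E)
    (h : ∀ c : ℝ, 0 ≤ c → ∫⁻ u in Set.Ioi c, D u ≤ ∫⁻ u in Set.Ioi c, E u)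
    {k : ℝ → ℝ} (hk : Monotone k) (hk0 : ∀ u, 0 < u → 0 ≤ k u) :
    ∫⁻ u in Set.Ioi (0 : ℝ), D u * ENNReal.ofReal (k u) ≤
      ∫⁻ u in Set.Ioi (0 : ℝ), E u * ENNReal.ofReal (k u) := by
  have layer : ∀ F : ℝ → ENNReal, Measurable F →
      ∫⁻ u in Set.Ioi (0 : ℝ), F u * ENNReal.ofReal (k u) =
        ∫⁻ v in Set.Ioi (0 : ℝ), ∫⁻ u in {u | 0 < u ∧ v < k u}, F u := by
    intro F hF
    have hkm : Measurable fun u => ENNReal.ofReal (k u) := hk.measurable.ennreal_ofReal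
    refine (setLIntegral_withDensity_eq_setLIntegral_mul _ hF hkm measurableSet_Ioi).symm.trans ?_
    rw [lintegral_eq_lintegral_meas_lt]
    · refine lintegral_congr fun v => ?_
      have hm : MeasurableSet {u | v < k u} := measurableSet_lt measurable_const hk.measurable
      rw [Measure.restrict_apply hm, withDensity_apply _ (hm.inter measurableSet_Ioi)]
      congr 2
      ext u
      exact and_comm
    · exact (ae_restrict_iff' measurableSet_Ioi).2 (Filter.Eventually.of_forall hk0)
    · exact hk.measurable.aemeasurable
  rw [layer D hD, layer E hE]
  refine lintegral_mono fun v => ?_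
  set S : Set ℝ := {u | 0 < u ∧ v < k u} with hS
  rcases S.eq_empty_or_nonempty with hemp | hne
  · simp [hemp]
  have hbdd : BddBelow S := ⟨0, fun u hu => hu.1.le⟩
  have hc : 0 ≤ sInf S := le_csInf hne fun u hu => hu.1.le
  have h1 : Set.Ioi (sInf S) ⊆ S := by
    intro u hu
    obtain ⟨w, hw, hwu⟩ := exists_lt_of_csInf_lt hne hu
    exact ⟨hw.1.trans hwu, hw.2.trans_le (hk hwu.le)⟩
  have h2 : S ⊆ Set.Ici (sInf S) := fun u hu => csInf_le hbdd hu
  calc ∫⁻ u in S, D u ≤ ∫⁻ u in Set.Ici (sInf S), D u := lintegral_mono_set h2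
    _ = ∫⁻ u in Set.Ioi (sInf S), D u := by rw [restrict_Ioi_eq_restrict_Ici]
    _ ≤ ∫⁻ u in Set.Ioi (sInf S), E u := h _ hc
    _ ≤ ∫⁻ u in S, E u := lintegral_mono_set h1

/-! ### Layer-cake formulas and supporting lines -/

theorem lintegral_ofReal_max_sub {α : Type*} [MeasurableSpace α] (m : Measure α) {x : α → ℝ}
    (hx : AEMeasurable x m) (c : ℝ) :
    ∫⁻ ω, ENNReal.ofReal (max (x ω - c) 0) ∂m = ∫⁻ u in Set.Ioi c, m {ω | u < x ω} := by
  have hm : AEMeasurable (fun ω => max (x ω - c) 0) m := (hx.sub_const c).max aemeasurable_const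
  rw [lintegral_eq_lintegral_meas_lt (f := fun ω => max (x ω - c) 0) m
    (Filter.Eventually.of_forall fun ω => le_max_right _ _) hm]
  have hpre : Set.Ioi (0 : ℝ) = (fun u => u + c) ⁻¹' Set.Ioi c := by ext; simp
  rw [hpre, ← (measurePreserving_add_right volume c).setLIntegral_comp_preimage
    measurableSet_Ioi (antitone_measure_lt m x).measurable]
  refine setLIntegral_congr_fun (measurableSet_Ioi.preimage (measurable_add_const c)) ?_
  intro u hu
  have hu : 0 < u := by simpa using hu
  refine congrArg m (Set.ext fun ω => ?_)
  simp only [Set.mem_ofPred_eq, lt_max_iff, not_lt.2 hu.le, or_false, lt_sub_iff_add_lt]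

/-- Layer cake applied to `g(x) = ∫_0^x g'`, with the right derivative because `g` may have corners.
-/
theorem ConvexOn.lintegral_ofReal_comp {α : Type*} [MeasurableSpace α] (m : Measure α)
    {x : α → ℝ} (hx : AEMeasurable x m) (hx0 : ∀ ω, 0 ≤ x ω) {g : ℝ → ℝ}
    (hg : ConvexOn ℝ Set.univ g) (hg0 : g 0 = 0) (hgnn : ∀ u, 0 < u → 0 ≤ derivWithin g (Set.Ioi u) u) :
    ∫⁻ ω, ENNReal.ofReal (g (x ω)) ∂m =
      ∫⁻ u in Set.Ioi (0 : ℝ), m {ω | u < x ω} * ENNReal.ofReal (derivWithin g (Set.Ioi u) u) := by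
  have hmono : Monotone fun u => derivWithin g (Set.Ioi u) u := by
    have := hg.monotoneOn_rightDeriv
    rwa [interior_univ, monotoneOn_univ] at this
  rw [← lintegral_comp_eq_lintegral_meas_lt_mul m (Filter.Eventually.of_forall hx0) hx
    (fun t _ => hmono.intervalIntegrable)
    ((ae_restrict_iff' measurableSet_Ioi).2 (Filter.Eventually.of_forall hgnn))]
  refine lintegral_congr fun ω => ?_
  have hcont : Continuous g := by
    have := hg.continuousOn isOpen_univ
    rwa [← continuousOn_univ]
  rw [intervalIntegral.integral_eq_sub_of_hasDeriv_right hcont.continuousOn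
    (fun u _ => hg.hasDerivWithinAt_rightDeriv_of_mem_interior (by simp))
    hmono.intervalIntegrable, hg0, sub_zero]

theorem ConvexOn.exists_nonneg_sub_linear {f : ℝ → ℝ} (hf : ConvexOn ℝ Set.univ f)
    (hf0 : f 0 = 0) : ∃ a : ℝ, ∀ t, 0 ≤ f t - a * t := by
  refine ⟨derivWithin f (Set.Ioi 0) 0, fun t => ?_⟩
  rcases lt_trichotomy t 0 with ht | rfl | ht
  · have h1 := hf.slope_le_leftDeriv_of_mem_interior (x := t) (y := 0) (by simp) (by simp) ht
    have h2 := h1.trans (hf.leftDeriv_le_rightDeriv_of_mem_interior (by simp))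
    rw [slope_def_field, hf0, zero_sub, zero_sub, neg_div_neg_eq, div_le_iff_of_neg ht] at h2
    linarith
  · simp [hf0]
  · have h1 := hf.rightDeriv_le_slope_of_mem_interior (x := 0) (y := t) (by simp) (by simp) ht
    rw [slope_def_field, hf0, sub_zero, sub_zero, le_div_iff₀ ht] at h1
    linarith

theorem ConvexOn.rightDeriv_nonneg_of_nonneg {g : ℝ → ℝ} (hg : ConvexOn ℝ Set.univ g)
    (hg0 : g 0 = 0) (hgnn : ∀ t, 0 ≤ g t) {u : ℝ} (hu : 0 < u) :
    0 ≤ derivWithin g (Set.Ioi u) u := by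
  have h1 := hg.slope_le_leftDeriv_of_mem_interior (x := 0) (y := u) (by simp) (by simp) hu
  refine le_trans ?_ (h1.trans (hg.leftDeriv_le_rightDeriv_of_mem_interior (by simp)))
  rw [slope_def_field, hg0, sub_zero, sub_zero]
  exact div_nonneg (hgnn u) hu.le

/-! ### From majorization to convex inequalities -/

theorem isSubmajorized_iff {α : Type*} [MeasurableSpace α] (m : Measure α) {x y : α → ℝ}
    (hx : Integrable x m) (hy : Integrable y m) :
    IsSubmajorized m (fun u => max (x u) 0) (fun u => max (y u) 0) ↔
      ∀ c : ℝ, 0 ≤ c → ∫⁻ u in Set.Ioi c, m {ω | u < x ω} ≤ ∫⁻ u in Set.Ioi c, m {ω | u < y ω} := by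
  have hpos : ∀ (z : α → ℝ) (t : ℝ),
      ∫⁻ s in Set.Ioo 0 t, decreasingRearrangement m (fun u => max (z u) 0) s =
        ∫⁻ u in Set.Ioi (0 : ℝ), min (m {ω | u < z ω}) (ENNReal.ofReal t) := by
    intro z t
    rw [lintegral_decreasingRearrangement]
    refine setLIntegral_congr_fun measurableSet_Ioi fun u hu => ?_
    have hu : 0 < u := hu
    have : {ω | u < |max (z ω) 0|} = {ω | u < z ω} := by
      ext ω
      simp only [Set.mem_ofPred_eq, abs_of_nonneg (le_max_right (z ω) 0), lt_max_iff,
        not_lt.2 hu.le, or_false]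
    simp only [this]
  simp only [IsSubmajorized, hpos]
  constructor
  · intro h c hc
    exact lintegral_Ioi_le_of_forall_pos (fun c hc =>
      lintegral_Ioi_le_of_lintegral_min_le (antitone_measure_lt m x)
        (fun u hu => (hx.measure_gt_lt_top hu).ne) h hc) hc
  · intro h t ht
    refine lintegral_min_le_of_lintegral_Ioi_le (antitone_measure_lt m y) ?_ h ht
    have hm : ∀ u : ℝ, NullMeasurableSet {ω | u < y ω} m := fun u =>
      nullMeasurableSet_lt aemeasurable_const hy.aemeasurable
    -- Continuity from above, available because integrability makes the superlevel set at `1`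
    -- finite.
    have := tendsto_measure_iInter_atTop (μ := m) (s := fun u : ℝ => {ω | u < y ω}) hm
      (fun a b hab ω hω => lt_of_le_of_lt hab hω) ⟨1, (hy.measure_gt_lt_top one_pos).ne⟩
    have hempty : ⋂ u : ℝ, {ω | u < y ω} = ∅ := by
      ext ω
      simp only [Set.mem_iInter, Set.mem_ofPred_eq, Set.mem_empty_iff_false, iff_false, not_forall]
      exact ⟨y ω, lt_irrefl _⟩
    rwa [hempty, measure_empty] at this

theorem lintegral_ofReal_comp_max_le {α : Type*} [MeasurableSpace α] (m : Measure α)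
    {x y : α → ℝ} (hx : Integrable x m) (hy : Integrable y m)
    (h : IsSubmajorized m (fun u => max (x u) 0) (fun u => max (y u) 0)) {g : ℝ → ℝ}
    (hg : ConvexOn ℝ Set.univ g) (hg0 : g 0 = 0) (hgnn : ∀ t, 0 ≤ g t) :
    ∫⁻ ω, ENNReal.ofReal (g (max (x ω) 0)) ∂m ≤ ∫⁻ ω, ENNReal.ofReal (g (max (y ω) 0)) ∂m := by
  have hd : ∀ u : ℝ, 0 < u → 0 ≤ derivWithin g (Set.Ioi u) u :=
    fun u hu => hg.rightDeriv_nonneg_of_nonneg hg0 hgnn hu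
  have hmono : Monotone fun u => derivWithin g (Set.Ioi u) u := by
    have := hg.monotoneOn_rightDeriv
    rwa [interior_univ, monotoneOn_univ] at this
  rw [hg.lintegral_ofReal_comp m (hx.aemeasurable.max aemeasurable_const)
      (fun ω => le_max_right _ _) hg0 hd,
    hg.lintegral_ofReal_comp m (hy.aemeasurable.max aemeasurable_const)
      (fun ω => le_max_right _ _) hg0 hd]
  refine lintegral_mul_le_of_lintegral_Ioi_le (antitone_measure_lt m _).measurable
    (antitone_measure_lt m _).measurable ?_ hmono hd
  refine (isSubmajorized_iff m (hx.pos_part) (hy.pos_part)).1 ?_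
  simpa using h

theorem ConvexOn.comp_neg_univ {g : ℝ → ℝ} (hg : ConvexOn ℝ Set.univ g) :
    ConvexOn ℝ Set.univ fun t => g (-t) := by
  have := hg.comp_linearMap (-LinearMap.id : ℝ →ₗ[ℝ] ℝ)
  simpa [Function.comp_def] using this

theorem IsMajorized.integral_convex_le {α : Type*} [MeasurableSpace α] {m : Measure α}
    {x y : α → ℝ} (hx : Integrable x m) (hy : Integrable y m) (h : IsMajorized m x y) {f : ℝ → ℝ}
    (hf : ConvexOn ℝ Set.univ f) (hf0 : f 0 = 0) (hfx : Integrable (fun u => f (x u)) m)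
    (hfy : Integrable (fun u => f (y u)) m) : ∫ u, f (x u) ∂m ≤ ∫ u, f (y u) ∂m := by
  obtain ⟨h1, h2, h3⟩ := h
  obtain ⟨a, ha⟩ := hf.exists_nonneg_sub_linear hf0
  set g : ℝ → ℝ := fun t => f t - a * t with hgdef
  have hg : ConvexOn ℝ Set.univ g := by
    refine hf.sub ⟨convex_univ, fun s _ t _ p q _ _ _ => ?_⟩
    simp only [smul_eq_mul]
    exact le_of_eq (by ring)
  have hg0 : g 0 = 0 := by simp [hgdef, hf0]
  have hgm : Measurable g :=
    (continuousOn_univ.1 (hg.continuousOn isOpen_univ)).measurable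
  -- At each point one of the two arguments is `0`, where `g` vanishes.
  have hsplit : ∀ z : α → ℝ, Integrable z m → ∫⁻ ω, ENNReal.ofReal (g (z ω)) ∂m =
      (∫⁻ ω, ENNReal.ofReal (g (max (z ω) 0)) ∂m) +
        ∫⁻ ω, ENNReal.ofReal (g (-max (-z ω) 0)) ∂m := by
    intro z hz
    have hm : AEMeasurable (fun ω => ENNReal.ofReal (g (max (z ω) 0))) m :=
      (hgm.comp_aemeasurable (hz.aemeasurable.max aemeasurable_const)).ennreal_ofReal
    rw [← lintegral_add_left' hm]
    refine lintegral_congr fun ω => ?_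
    rcases le_total 0 (z ω) with h0 | h0
    · rw [max_eq_left h0, max_eq_right (neg_nonpos.2 h0), neg_zero, hg0]
      simp
    · rw [max_eq_right h0, max_eq_left (neg_nonneg.2 h0), neg_neg, hg0]
      simp
  have hgx : Integrable (fun u => g (x u)) m := hfx.sub (hx.const_mul a)
  have hgy : Integrable (fun u => g (y u)) m := hfy.sub (hy.const_mul a)
  have key : ∫ u, g (x u) ∂m ≤ ∫ u, g (y u) ∂m := by
    rw [integral_eq_lintegral_of_nonneg_ae (Filter.Eventually.of_forall fun u => ha _) hgx.1,
      integral_eq_lintegral_of_nonneg_ae (Filter.Eventually.of_forall fun u => ha _) hgy.1]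
    refine ENNReal.toReal_mono (Integrable.lintegral_lt_top hgy).ne ?_
    rw [hsplit x hx, hsplit y hy]
    exact add_le_add (lintegral_ofReal_comp_max_le m hx hy h1 hg hg0 ha)
      (lintegral_ofReal_comp_max_le m hx.neg hy.neg h2 hg.comp_neg_univ (by simpa using hg0)
        fun t => ha _)
  -- The linear corrections are equal, as `x` and `y` have the same integral.
  simp only [hgdef] at key
  rw [integral_sub hfx (hx.const_mul a), integral_sub hfy (hy.const_mul a),
    integral_const_mul, integral_const_mul, h3] at key
  linarith

/-! ### From convex inequalities to majorization -/

theorem convexOn_max_sub_zero (c : ℝ) : ConvexOn ℝ Set.univ fun t : ℝ => max (t - c) 0 :=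
  ((convexOn_id convex_univ).sub (concaveOn_const c convex_univ)).sup
    (convexOn_const 0 convex_univ)

theorem Integrable.max_sub_zero {α : Type*} [MeasurableSpace α] {m : Measure α} {x : α → ℝ}
    (hx : Integrable x m) {c : ℝ} (hc : 0 ≤ c) : Integrable (fun u => max (x u - c) 0) m := by
  refine hx.mono ((hx.aemeasurable.sub_const c).max aemeasurable_const).aestronglyMeasurable
    (Filter.Eventually.of_forall fun u => ?_)
  rw [Real.norm_eq_abs, Real.norm_eq_abs, abs_of_nonneg (le_max_right _ _)]
  exact max_le (by linarith [le_abs_self (x u)]) (abs_nonneg _)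

theorem isSubmajorized_of_integral_max_sub_le {α : Type*} [MeasurableSpace α] {m : Measure α}
    {x y : α → ℝ} (hx : Integrable x m) (hy : Integrable y m)
    (h : ∀ c : ℝ, 0 ≤ c → ∫ u, max (x u - c) 0 ∂m ≤ ∫ u, max (y u - c) 0 ∂m) :
    IsSubmajorized m (fun u => max (x u) 0) (fun u => max (y u) 0) := by
  rw [isSubmajorized_iff m hx hy]
  intro c hc
  rw [← lintegral_ofReal_max_sub m hx.aemeasurable, ← lintegral_ofReal_max_sub m hy.aemeasurable,
    ← ofReal_integral_eq_lintegral_ofReal (Integrable.max_sub_zero hx hc)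
      (Filter.Eventually.of_forall fun u => le_max_right _ _),
    ← ofReal_integral_eq_lintegral_ofReal (Integrable.max_sub_zero hy hc)
      (Filter.Eventually.of_forall fun u => le_max_right _ _)]
  exact ENNReal.ofReal_le_ofReal (h c hc)

theorem mainTheorem8 (x y : ℝ → ℝ)
    (hx : Integrable x (volume.restrict (Set.Ioi (0 : ℝ))))
    (hy : Integrable y (volume.restrict (Set.Ioi (0 : ℝ)))) :
    IsMajorized (volume.restrict (Set.Ioi (0 : ℝ))) x y ↔
      ∀ f : ℝ → ℝ, ConvexOn ℝ Set.univ f → f 0 = 0 →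
        Integrable (fun u => f (x u)) (volume.restrict (Set.Ioi (0 : ℝ))) →
        Integrable (fun u => f (y u)) (volume.restrict (Set.Ioi (0 : ℝ))) →
        ∫ u in Set.Ioi (0 : ℝ), f (x u) ≤ ∫ u in Set.Ioi (0 : ℝ), f (y u) := by
  constructor
  · intro h f hf hf0 hfx hfy
    exact h.integral_convex_le hx hy hf hf0 hfx hfy
  · intro h
    refine ⟨isSubmajorized_of_integral_max_sub_le hx hy fun c hc => ?_,
      isSubmajorized_of_integral_max_sub_le hx.neg hy.neg fun c hc => ?_, le_antisymm ?_ ?_⟩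
    · exact h _ (convexOn_max_sub_zero c) (by simp [hc]) (Integrable.max_sub_zero hx hc)
        (Integrable.max_sub_zero hy hc)
    · exact h _ (convexOn_max_sub_zero c).comp_neg_univ (by simp [hc])
        (Integrable.max_sub_zero hx.neg hc) (Integrable.max_sub_zero hy.neg hc)
    · exact h id (convexOn_id convex_univ) rfl hx hy
    · have := h (fun t => -t) (convexOn_id convex_univ).comp_neg_univ neg_zero hx.neg hy.neg
      rw [integral_neg, integral_neg] at this
      exact neg_le_neg_iff.1 this
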